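/- Let $k$ be an algebraically closed field and $n\ge 1$. A (finite-dimensional) module over the path algebra of the $n$-Kronecker quiver is a tuple $M=(M_1,M_2,(\gamma_i)_{1\le i\le n})$ of finite-dimensional $k$-vector spaces $M_1,M_2$ and linear maps $\gamma_i:M_1\to M_2$; its dimension vector is $(\dim M_1,\dim M_2)$. Let $\sigma,\sigma^-$ be the Bernstein--Gelfand--Ponomarev reflections, so that $\sigma M=(\ker(M_1^n\to M_2),M_1)$ with the coordinate projections and $\sigma^-M=(M_2,\operatorname{coker}(M_1\to M_2^n))$ with the maps induced by the coordinate inclusions. An indecomposable $M$ is preprojective (preinjective) if $\sigma^tM=0$ (respectively $(\sigma^-)^tM=0$) for some $t\ge0$; a module is regular if it has no indecomposable direct summand that is preprojective or preinjective. A nonzero regular module $M$ is elementary if there is no short exact sequence $0\to L\to M\to N\to 0$ with $L,N$ nonzero regular modules. Let $x,y\ge 0$ be integers with $\frac2n x\le y\le x$ and $x+y=n+1$. Let $X(x,y)$ be the module with $X_1=k^x$ and $X_2=k^y$, with standard bases $e_1,\dots,e_x$ and $e'_1,\dots,e'_y$, and with $\gamma_i e_j=e'_{i-j+1}$ for $1\le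 i\le n$, $1\le j\le x$, where $e'_l=0$ for $l\notin\{1,\dots,y\}$. Then $X(x,y)$ is elementary. Moreover, every nonzero element of $X_1$ generates a submodule of $X(x,y)$ of dimension vector $(1,y)$. -/

import Mathlib

universe u

/-- A finite-dimensional representation over `k` of the `n`-Kronecker quiver: two vertices
`1` (the source) and `2` (the sink), and `n` arrows `γ i : 1 → 2`. -/
structure KroneckerRep (k : Type u) [Field k] (n : ℕ) where
  V₁ : Type u
  V₂ : Type u
  [addCommGroup₁ : AddCommGroup V₁]
  [addCommGroup₂ : AddCommGroup V₂]
  [module₁ : Module k V₁]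
  [module₂ : Module k V₂]
  [finite₁ : FiniteDimensional k V₁]
  [finite₂ : FiniteDimensional k V₂]
  γ : Fin n → V₁ →ₗ[k] V₂

namespace KroneckerRep

attribute [instance] addCommGroup₁ addCommGroup₂ module₁ module₂ finite₁ finite₂

variable {k : Type u} [Field k] {n : ℕ}

/-- Morphisms of representations. -/
structure Hom (M N : KroneckerRep k n) where
  f₁ : M.V₁ →ₗ[k] N.V₁
  f₂ : M.V₂ →ₗ[k] N.V₂
  comm : ∀ (i : Fin n) (m : M.V₁), f₂ (M.γ i m) = N.γ i (f₁ m)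

/-- Isomorphisms of representations. -/
structure Iso (M N : KroneckerRep k n) where
  e₁ : M.V₁ ≃ₗ[k] N.V₁
  e₂ : M.V₂ ≃ₗ[k] N.V₂
  comm : ∀ (i : Fin n) (m : M.V₁), e₂ (M.γ i m) = N.γ i (e₁ m)

/-- The dimension vector. -/
noncomputable def dimVec (M : KroneckerRep k n) : ℕ × ℕ :=
  (Module.finrank k M.V₁, Module.finrank k M.V₂)

/-- `M` is the zero representation. -/
def IsZero (M : KroneckerRep k n) : Prop :=
  Subsingleton M.V₁ ∧ Subsingleton M.V₂

/-- The direct sum of two representations. -/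
def directSum (M N : KroneckerRep k n) : KroneckerRep k n where
  V₁ := M.V₁ × N.V₁
  V₂ := M.V₂ × N.V₂
  γ i := (M.γ i).prodMap (N.γ i)

/-- Indecomposable representations (nonzero by convention). -/
def IsIndecomposable (M : KroneckerRep k n) : Prop :=
  ¬ M.IsZero ∧ ∀ A B : KroneckerRep k n, Nonempty (Iso M (A.directSum B)) → A.IsZero ∨ B.IsZero

/-- The map `M₁ⁿ → M₂`, `(m_i)_i ↦ ∑ i, γ_i m_i`. -/
def sumMap (M : KroneckerRep k n) : (Fin n → M.V₁) →ₗ[k] M.V₂ :=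
  ∑ i, (M.γ i).comp (LinearMap.proj i)

/-- The map `M₁ → M₂ⁿ`, `m ↦ (γ_i m)_i`. -/
def tupleMap (M : KroneckerRep k n) : M.V₁ →ₗ[k] (Fin n → M.V₂) :=
  LinearMap.pi M.γ

/-- The Bernstein–Gelfand–Ponomarev reflection at the sink, with the opposite quiver identified
with the `n`-Kronecker quiver again: `(σ M)₁ = ker (M₁ⁿ → M₂)` and `(σ M)₂ = M₁`, and the
arrows act by the coordinate projections. -/
def sigma (M : KroneckerRep k n) : KroneckerRep k n where
  V₁ := LinearMap.ker M.sumMap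
  V₂ := M.V₁
  γ i := (LinearMap.proj i).comp (LinearMap.ker M.sumMap).subtype

/-- The Bernstein–Gelfand–Ponomarev reflection at the source, with the opposite quiver identified
with the `n`-Kronecker quiver again: `(σ⁻ M)₁ = M₂` and `(σ⁻ M)₂ = coker (M₁ → M₂ⁿ)`, and the
arrows act by the coordinate inclusions. -/
def sigmaInv (M : KroneckerRep k n) : KroneckerRep k n where
  V₁ := M.V₂
  V₂ := (Fin n → M.V₂) ⧸ LinearMap.range M.tupleMap
  γ i := (LinearMap.range M.tupleMap).mkQ.comp (LinearMap.single k (fun _ => M.V₂) i)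

/-- Preprojective: indecomposable and `σᵗ M = 0` for some `t ≥ 0`. -/
def IsPreprojective (M : KroneckerRep k n) : Prop :=
  M.IsIndecomposable ∧ ∃ t : ℕ, (sigma^[t] M).IsZero

/-- Preinjective: indecomposable and `σ⁻ᵗ M = 0` for some `t ≥ 0`. -/
def IsPreinjective (M : KroneckerRep k n) : Prop :=
  M.IsIndecomposable ∧ ∃ t : ℕ, (sigmaInv^[t] M).IsZero

/-- Regular: no indecomposable direct summand is preprojective or preinjective. -/
def IsRegular (M : KroneckerRep k n) : Prop :=
  ∀ A B : KroneckerRep k n, Nonempty (Iso M (A.directSum B)) →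
    ¬ A.IsPreprojective ∧ ¬ A.IsPreinjective

/-- `0 → L → M → N → 0` is a short exact sequence. -/
structure IsShortExact {L M N : KroneckerRep k n} (f : Hom L M) (g : Hom M N) : Prop where
  injective₁ : Function.Injective f.f₁
  injective₂ : Function.Injective f.f₂
  exact₁ : Function.Exact f.f₁ g.f₁
  exact₂ : Function.Exact f.f₂ g.f₂
  surjective₁ : Function.Surjective g.f₁
  surjective₂ : Function.Surjective g.f₂

/-- Elementary: nonzero regular, and not the middle term of a short exact sequence whose outer
terms are nonzero and regular. -/
def IsElementary (M : KroneckerRep k n) : Prop :=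
  ¬ M.IsZero ∧ M.IsRegular ∧
    ¬ ∃ (L N : KroneckerRep k n) (f : Hom L M) (g : Hom M N),
      IsShortExact f g ∧ ¬ L.IsZero ∧ L.IsRegular ∧ ¬ N.IsZero ∧ N.IsRegular

/-- Subrepresentations (submodules). -/
structure Subrep (M : KroneckerRep k n) where
  W₁ : Submodule k M.V₁
  W₂ : Submodule k M.V₂
  map_mem : ∀ (i : Fin n), ∀ m ∈ W₁, M.γ i m ∈ W₂

/-- A subrepresentation, as a representation. -/
def Subrep.toRep {M : KroneckerRep k n} (U : Subrep M) : KroneckerRep k n where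
  V₁ := U.W₁
  V₂ := U.W₂
  γ i := (M.γ i).restrict (U.map_mem i)

/-- The submodule generated by an element `m` of `M₁`. -/
def generatedBy (M : KroneckerRep k n) (m : M.V₁) : Subrep M where
  W₁ := Submodule.span k {m}
  W₂ := Submodule.span k (Set.range fun i => M.γ i m)
  map_mem i v hv := by
    obtain ⟨c, rfl⟩ := Submodule.mem_span_singleton.mp hv
    rw [map_smul]
    exact Submodule.smul_mem _ _ (Submodule.subset_span ⟨i, rfl⟩)

theorem mem_generatedBy (M : KroneckerRep k n) (m : M.V₁) : m ∈ (M.generatedBy m).W₁ :=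
  Submodule.mem_span_singleton_self m

/-- `generatedBy` is the smallest subrepresentation containing `m`. -/
theorem generatedBy_le (M : KroneckerRep k n) (m : M.V₁) (U : Subrep M) (hm : m ∈ U.W₁) :
    (M.generatedBy m).W₁ ≤ U.W₁ ∧ (M.generatedBy m).W₂ ≤ U.W₂ := by
  refine ⟨(Submodule.span_singleton_le_iff_mem m _).mpr hm, Submodule.span_le.mpr ?_⟩
  rintro _ ⟨i, rfl⟩
  exact U.map_mem i m hm

/-- The region `F` of dimension vectors `(x, y)` with `(2 / n) x ≤ y ≤ x`. -/
def F (n : ℕ) : Set (ℕ × ℕ) :=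
  {p | (2 / n : ℚ) * p.1 ≤ p.2 ∧ p.2 ≤ p.1}

/-- The module `X(x, y)`. With all indices counted from `0`, the arrow `γ_i` sends `e_j` to `e'_t`
if `i = j + t`, and to `0` if there is no such `t < y`. (Counting from `1`, this reads
`γ_i e_j = e'_{i - j + 1}`.) -/
def X (k : Type u) [Field k] (n x y : ℕ) : KroneckerRep k n where
  V₁ := Fin x → k
  V₂ := Fin y → k
  γ i := Matrix.mulVecLin
    (Matrix.of fun (t : Fin y) (j : Fin x) => if (i : ℕ) = (j : ℕ) + (t : ℕ) then (1 : k) else 0)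

end KroneckerRep

namespace KroneckerRep

variable {k : Type u} [Field k] {n : ℕ}

/-! Encode `m : Fin x → k` and a functional on `Fin y → k` with coordinates `w` as polynomials of
degree less than `x` and `y`. The functional takes on `γ i m` the `i`-th coefficient of their
product, whose degree is at most `x + y - 2 = n - 1`. A functional killing every `γ i m` thus makes
the product zero, and `k[T]` is a domain: each `m ≠ 0` generates the whole sink space
(`X_generatesSink`).

This property and the dimension bounds give elementarity (`GeneratesSink.isElementary`). In a short
exact sequence either the submodule vanishes at the source or the quotient vanishes at the sink, so
one of them splits off a simple preprojective or preinjective module. A nonzero direct summand has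
full dimension, and the bounds defining `F` prevent iterated reflections from killing it. -/

/-! ### Growth of dimensions under the reflections -/

theorem isZero_iff_finrank (M : KroneckerRep k n) :
    M.IsZero ↔ Module.finrank k M.V₁ = 0 ∧ Module.finrank k M.V₂ = 0 := by
  simp only [IsZero, Module.finrank_zero_iff]

theorem le_finrank_sigma (M : KroneckerRep k n) :
    n * Module.finrank k M.V₁ ≤ Module.finrank k M.sigma.V₁ + Module.finrank k M.V₂ := by
  have h := M.sumMap.finrank_range_add_finrank_ker
  have hr := Submodule.finrank_le (LinearMap.range M.sumMap)
  rw [Module.finrank_pi_fintype] at h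
  simp only [Finset.sum_const, Finset.card_univ, Fintype.card_fin, smul_eq_mul] at h
  change _ ≤ Module.finrank k (LinearMap.ker M.sumMap) + _
  omega

theorem le_finrank_sigmaInv (M : KroneckerRep k n) :
    n * Module.finrank k M.V₂ ≤ Module.finrank k M.sigmaInv.V₂ + Module.finrank k M.V₁ := by
  have h := (LinearMap.range M.tupleMap).finrank_quotient_add_finrank
  have hr := M.tupleMap.finrank_range_le
  rw [Module.finrank_pi_fintype] at h
  simp only [Finset.sum_const, Finset.card_univ, Fintype.card_fin, smul_eq_mul] at h
  change _ ≤ Module.finrank k ((Fin n → M.V₂) ⧸ LinearMap.range M.tupleMap) + _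
  omega

/-- If `0 < dim M₁` and `dim M₂ ≤ dim M₁`, then no iterate of `σ` kills `M`. -/
theorem not_isZero_iterate_sigma (hn : 2 ≤ n) (M : KroneckerRep k n)
    (h0 : 0 < Module.finrank k M.V₁) (h : Module.finrank k M.V₂ ≤ Module.finrank k M.V₁) (t : ℕ) :
    ¬ (sigma^[t] M).IsZero := by
  induction t generalizing M with
  | zero =>
    rw [Function.iterate_zero_apply, isZero_iff_finrank]
    omega
  | succ t ih =>
    have h1 := M.le_finrank_sigma
    have h2 : 2 * Module.finrank k M.V₁ ≤ n * Module.finrank k M.V₁ := Nat.mul_le_mul_right _ hn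
    -- The `V₂` of `M.sigma` is `M.V₁`, so this is the hypothesis `h` for `M.sigma`.
    have h3 : Module.finrank k M.V₁ ≤ Module.finrank k M.sigma.V₁ := by omega
    rw [Function.iterate_succ_apply]
    exact ih _ (h0.trans_le h3) h3

/-- If `0 < dim M₂` and `2 * dim M₁ ≤ n * dim M₂`, then no iterate of `σ⁻` kills `M`. -/
theorem not_isZero_iterate_sigmaInv (hn : 2 ≤ n) (M : KroneckerRep k n)
    (h0 : 0 < Module.finrank k M.V₂)
    (h : 2 * Module.finrank k M.V₁ ≤ n * Module.finrank k M.V₂) (t : ℕ) :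
    ¬ (sigmaInv^[t] M).IsZero := by
  induction t generalizing M with
  | zero =>
    rw [Function.iterate_zero_apply, isZero_iff_finrank]
    omega
  | succ t ih =>
    have h1 := M.le_finrank_sigmaInv
    have h2 : 2 * Module.finrank k M.V₂ ≤ n * Module.finrank k M.V₂ := Nat.mul_le_mul_right _ hn
    -- With `d = n * dim M₂`: the new dimension is at least `d - dim M₁ ≥ d / 2 ≥ dim M₂`.
    have h3 : Module.finrank k M.V₂ ≤ Module.finrank k M.sigmaInv.V₂ := by omega
    rw [Function.iterate_succ_apply]
    refine ih _ (h0.trans_le h3) ?_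
    change 2 * Module.finrank k M.V₂ ≤ _
    exact h2.trans (Nat.mul_le_mul_left _ h3)

/-! ### Direct sums and simple summands -/

theorem Iso.finrank_add {M A B : KroneckerRep k n} (e : Iso M (A.directSum B)) :
    Module.finrank k M.V₁ = Module.finrank k A.V₁ + Module.finrank k B.V₁ ∧
      Module.finrank k M.V₂ = Module.finrank k A.V₂ + Module.finrank k B.V₂ :=
  ⟨e.e₁.finrank_eq.trans (Module.finrank_prod (R := k) (M := A.V₁) (M' := B.V₁)),
    e.e₂.finrank_eq.trans (Module.finrank_prod (R := k) (M := A.V₂) (M' := B.V₂))⟩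

theorem isIndecomposable_of_finrank_add_eq_one (M : KroneckerRep k n)
    (h : Module.finrank k M.V₁ + Module.finrank k M.V₂ = 1) : M.IsIndecomposable := by
  refine ⟨fun h0 => ?_, fun A B ⟨e⟩ => ?_⟩
  · rw [isZero_iff_finrank] at h0
    omega
  · have := e.finrank_add
    rw [isZero_iff_finrank, isZero_iff_finrank]
    omega

/-- A single `σ` suffices, since both components of `σ M` are built from `M₁ = 0`. -/
theorem isPreprojective_of_finrank (M : KroneckerRep k n) (h₁ : Module.finrank k M.V₁ = 0)
    (h₂ : Module.finrank k M.V₂ = 1) : M.IsPreprojective := by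
  refine ⟨M.isIndecomposable_of_finrank_add_eq_one (by omega), 1, ?_⟩
  have : Subsingleton M.V₁ := Module.finrank_zero_iff.mp h₁
  exact ⟨inferInstanceAs (Subsingleton (LinearMap.ker M.sumMap)), this⟩

theorem isPreinjective_of_finrank (M : KroneckerRep k n) (h₁ : Module.finrank k M.V₁ = 1)
    (h₂ : Module.finrank k M.V₂ = 0) : M.IsPreinjective := by
  refine ⟨M.isIndecomposable_of_finrank_add_eq_one (by omega), 1, ?_⟩
  have : Subsingleton M.V₂ := Module.finrank_zero_iff.mp h₂
  refine ⟨this, ?_⟩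
  change Subsingleton ((Fin n → M.V₂) ⧸ LinearMap.range M.tupleMap)
  infer_instance

/-- A pair of complementary subrepresentations decomposes a representation. -/
theorem Subrep.nonempty_iso_directSum {M : KroneckerRep k n} (U W : Subrep M)
    (h₁ : IsCompl U.W₁ W.W₁) (h₂ : IsCompl U.W₂ W.W₂) :
    Nonempty (Iso M (U.toRep.directSum W.toRep)) := by
  refine ⟨⟨(Submodule.prodEquivOfIsCompl _ _ h₁).symm,
    (Submodule.prodEquivOfIsCompl _ _ h₂).symm, fun i m => ?_⟩⟩
  obtain ⟨⟨a, b⟩, rfl⟩ := (Submodule.prodEquivOfIsCompl _ _ h₁).surjective m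
  refine Eq.trans (b := (U.toRep.γ i a, W.toRep.γ i b))
    ((LinearEquiv.symm_apply_eq (Submodule.prodEquivOfIsCompl _ _ h₂)).mpr ?_)
    (congrArg ((U.toRep.directSum W.toRep).γ i) (LinearEquiv.symm_apply_apply _ (a, b))).symm
  rw [Submodule.coe_prodEquivOfIsCompl', map_add]
  exact (Submodule.coe_prodEquivOfIsCompl' _ _ h₂ (U.toRep.γ i a, W.toRep.γ i b)).symm

/-- A nonzero representation supported at the sink is not regular. -/
theorem not_isRegular_of_subsingleton_V₁ (M : KroneckerRep k n) [Subsingleton M.V₁]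
    (h : ¬ M.IsZero) : ¬ M.IsRegular := by
  intro hM
  have hne : Nontrivial M.V₂ := not_subsingleton_iff_nontrivial.mp fun h2 => h ⟨‹_›, h2⟩
  obtain ⟨v, hv⟩ := exists_ne (0 : M.V₂)
  obtain ⟨q, hq⟩ := Submodule.exists_isCompl (Submodule.span k {v})
  have hγ (i : Fin n) (m : M.V₁) : M.γ i m = 0 := by rw [Subsingleton.elim m 0, map_zero]
  let U : Subrep M := ⟨⊥, Submodule.span k {v}, fun i m _ => by rw [hγ]; exact zero_mem _⟩
  let W : Subrep M := ⟨⊤, q, fun i m _ => by rw [hγ]; exact zero_mem _⟩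
  refine (hM _ _ (U.nonempty_iso_directSum W isCompl_bot_top hq)).1
    (isPreprojective_of_finrank _ (finrank_bot k M.V₁) (finrank_span_singleton hv))

/-- A nonzero representation supported at the source is not regular. -/
theorem not_isRegular_of_subsingleton_V₂ (M : KroneckerRep k n) [Subsingleton M.V₂]
    (h : ¬ M.IsZero) : ¬ M.IsRegular := by
  intro hM
  have hne : Nontrivial M.V₁ := not_subsingleton_iff_nontrivial.mp fun h1 => h ⟨h1, ‹_›⟩
  obtain ⟨v, hv⟩ := exists_ne (0 : M.V₁)
  obtain ⟨q, hq⟩ := Submodule.exists_isCompl (Submodule.span k {v})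
  let U : Subrep M := ⟨Submodule.span k {v}, ⊥, fun i m _ => Subsingleton.elim _ _⟩
  let W : Subrep M := ⟨q, ⊤, fun i m _ => Submodule.mem_top⟩
  refine (hM _ _ (U.nonempty_iso_directSum W hq isCompl_bot_top)).2
    (isPreinjective_of_finrank _ (finrank_span_singleton hv) (finrank_bot k M.V₂))

/-! ### Modules whose source elements generate the sink -/

/-- Every nonzero element of `M₁` generates all of `M₂`. -/
def GeneratesSink (M : KroneckerRep k n) : Prop :=
  ∀ m : M.V₁, m ≠ 0 → Submodule.span k (Set.range fun i => M.γ i m) = ⊤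

theorem GeneratesSink.surjective_of_hom {L M : KroneckerRep k n} (hM : M.GeneratesSink)
    (f : Hom L M) {l : L.V₁} (hl : f.f₁ l ≠ 0) : Function.Surjective f.f₂ := by
  rw [← LinearMap.range_eq_top, eq_top_iff, ← hM _ hl, Submodule.span_le]
  rintro _ ⟨i, rfl⟩
  exact ⟨L.γ i l, f.comm i l⟩

/-- The inclusion of the first summand of a decomposition. -/
def Iso.inl {M A B : KroneckerRep k n} (e : Iso M (A.directSum B)) : Hom A M where
  f₁ := e.e₁.symm.toLinearMap.comp (LinearMap.inl k A.V₁ B.V₁)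
  f₂ := e.e₂.symm.toLinearMap.comp (LinearMap.inl k A.V₂ B.V₂)
  comm i m := by
    refine (LinearEquiv.symm_apply_eq _).mpr ?_
    refine Eq.trans ?_ (e.comm i _).symm
    exact Eq.trans (b := (A.directSum B).γ i ((m, 0) : A.V₁ × B.V₁))
      (Prod.ext rfl (map_zero (B.γ i)).symm)
      (congrArg ((A.directSum B).γ i) (e.e₁.apply_symm_apply _)).symm

/-- The inclusion of the second summand of a decomposition. -/
def Iso.inr {M A B : KroneckerRep k n} (e : Iso M (A.directSum B)) : Hom B M where
  f₁ := e.e₁.symm.toLinearMap.comp (LinearMap.inr k A.V₁ B.V₁)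
  f₂ := e.e₂.symm.toLinearMap.comp (LinearMap.inr k A.V₂ B.V₂)
  comm i m := by
    refine (LinearEquiv.symm_apply_eq _).mpr ?_
    refine Eq.trans ?_ (e.comm i _).symm
    exact Eq.trans (b := (A.directSum B).γ i ((0, m) : A.V₁ × B.V₁))
      (Prod.ext (map_zero (A.γ i)).symm rfl)
      (congrArg ((A.directSum B).γ i) (e.e₁.apply_symm_apply _)).symm

theorem Iso.inl_f₁_ne_zero {M A B : KroneckerRep k n} (e : Iso M (A.directSum B)) {a : A.V₁}
    (ha : a ≠ 0) : e.inl.f₁ a ≠ 0 := fun h =>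
  ha (LinearMap.inl_injective (R := k) (M := A.V₁) (M₂ := B.V₁)
    (e.e₁.symm.injective ((show e.e₁.symm (a, 0) = 0 from h).trans (map_zero _).symm)))

theorem Iso.inr_f₁_ne_zero {M A B : KroneckerRep k n} (e : Iso M (A.directSum B)) {b : B.V₁}
    (hb : b ≠ 0) : e.inr.f₁ b ≠ 0 := fun h =>
  hb (LinearMap.inr_injective (R := k) (M := A.V₁) (M₂ := B.V₁)
    (e.e₁.symm.injective ((show e.e₁.symm (0, b) = 0 from h).trans (map_zero _).symm)))

/-- If every nonzero element of `M₁` generates `M₂`, then a nonzero direct summand of `M` has the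
same dimensions as `M`, provided that `M₁` and `M₂` are nonzero. -/
theorem GeneratesSink.finrank_eq_of_summand {M A B : KroneckerRep k n} (hM : M.GeneratesSink)
    (h₁ : 0 < Module.finrank k M.V₁) (h₂ : 0 < Module.finrank k M.V₂)
    (e : Iso M (A.directSum B)) (hA : ¬ A.IsZero) :
    Module.finrank k A.V₁ = Module.finrank k M.V₁ ∧
      Module.finrank k A.V₂ = Module.finrank k M.V₂ := by
  have hd := e.finrank_add
  have key₁ : 0 < Module.finrank k A.V₁ → Module.finrank k M.V₂ ≤ Module.finrank k A.V₂ := by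
    intro h
    have := Module.finrank_pos_iff.mp h
    obtain ⟨a, ha⟩ := exists_ne (0 : A.V₁)
    exact LinearMap.finrank_le_finrank_of_surjective
      (hM.surjective_of_hom e.inl (e.inl_f₁_ne_zero ha))
  have key₂ : 0 < Module.finrank k B.V₁ → Module.finrank k M.V₂ ≤ Module.finrank k B.V₂ := by
    intro h
    have := Module.finrank_pos_iff.mp h
    obtain ⟨b, hb⟩ := exists_ne (0 : B.V₁)
    exact LinearMap.finrank_le_finrank_of_surjective
      (hM.surjective_of_hom e.inr (e.inr_f₁_ne_zero hb))
  rw [isZero_iff_finrank] at hA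
  -- If `A₁ = 0`, then `B₁ = M₁ ≠ 0` forces `B₂ = M₂`, hence `A = 0`. If `A₁ ≠ 0`, then `A₂ = M₂`
  -- and `B₂ = 0`, which forces `B₁ = 0`.
  omega

theorem GeneratesSink.isElementary {M : KroneckerRep k n} (hM : M.GeneratesSink) (hn : 2 ≤ n)
    (h₁ : 0 < Module.finrank k M.V₁) (h₂ : 0 < Module.finrank k M.V₂)
    (hle : Module.finrank k M.V₂ ≤ Module.finrank k M.V₁)
    (hge : 2 * Module.finrank k M.V₁ ≤ n * Module.finrank k M.V₂) : M.IsElementary := by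
  refine ⟨fun h => ?_, fun A B ⟨e⟩ => ⟨fun ⟨hA, t, ht⟩ => ?_, fun ⟨hA, t, ht⟩ => ?_⟩, ?_⟩
  · rw [isZero_iff_finrank] at h
    omega
  · obtain ⟨hd₁, hd₂⟩ := hM.finrank_eq_of_summand h₁ h₂ e hA.1
    exact A.not_isZero_iterate_sigma hn (by omega) (by omega) t ht
  · obtain ⟨hd₁, hd₂⟩ := hM.finrank_eq_of_summand h₁ h₂ e hA.1
    exact A.not_isZero_iterate_sigmaInv hn (by omega) (by rwa [hd₁, hd₂]) t ht
  · rintro ⟨L, N, f, g, hfg, hL0, hL, hN0, hN⟩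
    rcases subsingleton_or_nontrivial L.V₁ with _ | _
    · exact L.not_isRegular_of_subsingleton_V₁ hL0 hL
    · obtain ⟨l, hl⟩ := exists_ne (0 : L.V₁)
      have hs := hM.surjective_of_hom f ((map_ne_zero_iff f.f₁ hfg.injective₁).mpr hl)
      -- `L` already contains all of `M₂`.
      have : Subsingleton N.V₂ := subsingleton_of_forall_eq 0 fun v => by
        obtain ⟨w, rfl⟩ := hfg.surjective₂ v
        exact (hfg.exact₂ w).mpr (hs w)
      exact N.not_isRegular_of_subsingleton_V₂ hN0 hN

/-! ### Polynomial multiplication and `X(x, y)` -/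

/-- If all coefficients of the product of the polynomials with coefficient vectors `m` and `w`
vanish, and `m ≠ 0`, then `w = 0`. -/
theorem eq_zero_of_convolution_eq_zero {x y : ℕ} (m : Fin x → k) (w : Fin y → k) (hm : m ≠ 0)
    (h : ∀ i : ℕ, ∑ t : Fin y, ∑ j : Fin x, (if i = j + t then w t * m j else 0) = 0) :
    w = 0 := by
  have coeff_sum {z : ℕ} (v : Fin z → k) (j : Fin z) :
      (∑ a : Fin z, Polynomial.monomial (a : ℕ) (v a)).coeff j = v j := by
    simp [Polynomial.coeff_monomial, Fin.val_inj]
  have hprod : (∑ t : Fin y, Polynomial.monomial (t : ℕ) (w t)) *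
      (∑ j : Fin x, Polynomial.monomial (j : ℕ) (m j)) = 0 := by
    ext i
    rw [Polynomial.coeff_zero, ← h i, Finset.sum_mul_sum, Polynomial.finsetSum_coeff]
    refine Finset.sum_congr rfl fun t _ => ?_
    rw [Polynomial.finsetSum_coeff]
    refine Finset.sum_congr rfl fun j _ => ?_
    rw [Polynomial.monomial_mul_monomial, Polynomial.coeff_monomial, add_comm]
    simp only [eq_comm]
  rcases mul_eq_zero.mp hprod with h0 | h0
  · funext t
    rw [← coeff_sum w t, h0]
    rfl
  · refine absurd (funext fun j => ?_) hm
    rw [← coeff_sum m j, h0]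
    rfl

theorem X_generatesSink {x y : ℕ} (hxy : x + y ≤ n + 1) : (X k n x y).GeneratesSink := by
  intro m hm
  change Fin x → k at m
  by_contra hne
  -- A proper subspace lies in the kernel of a nonzero functional.
  obtain ⟨f, hf0, hf⟩ := Submodule.exists_le_ker_of_lt_top _ (lt_top_iff_ne_top.mpr hne)
  change (Fin y → k) →ₗ[k] k at f
  have hfv (v : Fin y → k) : f v = ∑ t, v t * f (Pi.single t 1) := by
    conv_lhs => rw [pi_eq_sum_univ' v, map_sum]
    simp
  have hw : (fun t => f (Pi.single t 1)) = 0 := by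
    refine eq_zero_of_convolution_eq_zero m _ hm fun i => ?_
    by_cases hi : i < n
    · have := LinearMap.mem_ker.mp (hf (Submodule.subset_span ⟨⟨i, hi⟩, rfl⟩))
      refine Eq.trans ?_ this
      refine Eq.trans ?_ (hfv _).symm
      refine Finset.sum_congr rfl fun t _ => ?_
      change _ = (∑ j : Fin x, (if i = (j : ℕ) + t then (1 : k) else 0) * m j) * _
      rw [Finset.sum_mul]
      refine Finset.sum_congr rfl fun j _ => ?_
      split_ifs
      · rw [one_mul, mul_comm]
      · rw [zero_mul, zero_mul]
    -- No arrow has index `i ≥ n`, but none is needed: `j + t ≤ x + y - 2 < n`.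
    · refine Finset.sum_eq_zero fun t _ => Finset.sum_eq_zero fun j _ => if_neg ?_
      omega
  refine hf0 (LinearMap.ext fun v => (hfv v).trans ?_)
  exact Finset.sum_eq_zero fun t _ => by rw [congrFun hw t, Pi.zero_apply, mul_zero]

theorem GeneratesSink.dimVec_generatedBy {M : KroneckerRep k n} (hM : M.GeneratesSink) (m : M.V₁)
    (hm : m ≠ 0) : (M.generatedBy m).toRep.dimVec = (1, Module.finrank k M.V₂) := by
  refine Prod.ext (finrank_span_singleton hm) ?_
  change Module.finrank k (Submodule.span k (Set.range fun i => M.γ i m)) = _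
  rw [hM m hm, finrank_top]

end KroneckerRep

theorem mainTheorem3 (k : Type u) [Field k] [IsAlgClosed k] (n : ℕ) (hn : 1 ≤ n) (x y : ℕ)
    (hF : (x, y) ∈ KroneckerRep.F n) (hxy : x + y = n + 1) :
    (KroneckerRep.X k n x y).IsElementary ∧
      ∀ m : (KroneckerRep.X k n x y).V₁, m ≠ 0 →
        ((KroneckerRep.X k n x y).generatedBy m).toRep.dimVec = (1, y) := by
  have hX := KroneckerRep.X_generatesSink (k := k) hxy.le
  have h₁ : Module.finrank k (KroneckerRep.X k n x y).V₁ = x := Module.finrank_fin_fun k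
  have h₂ : Module.finrank k (KroneckerRep.X k n x y).V₂ = y := Module.finrank_fin_fun k
  obtain ⟨hge, hle⟩ := hF
  have hle' : y ≤ x := hle
  have hge' : 2 * x ≤ n * y := by
    have hn0 : (0 : ℚ) < n := by exact_mod_cast hn
    have h : (2 / n : ℚ) * x ≤ y := hge
    rw [div_mul_eq_mul_div, div_le_iff₀ hn0, mul_comm (y : ℚ)] at h
    exact_mod_cast h
  have hy : 0 < y := by
    rcases Nat.eq_zero_or_pos y with rfl | hy
    · omega
    · exact hy
  -- For `n = 1`, `2 * x ≤ y ≤ x` forces `x = y = 0`, against `x + y = 2`.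
  have hn2 : 2 ≤ n := by
    by_contra hlt
    obtain rfl : n = 1 := by omega
    omega
  refine ⟨hX.isElementary hn2 ?_ ?_ ?_ ?_, fun m hm => ?_⟩
  · omega
  · omega
  · omega
  · rwa [h₁, h₂]
  · rw [hX.dimVec_generatedBy m hm, h₂]
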